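/- Let $B_m$ denote the Bernoulli numbers, $\frac{x}{e^x-1}=\sum_{m\ge 0}\frac{B_m}{m!}x^m$ for $|x|<2\pi$; let $S_k^{(1)}(l)$ denote the (signed) Stirling numbers of the first kind, defined by $x(x+1)\cdots(x+k-1)=(-1)^k\sum_{l=0}^{k}(-1)^l S_k^{(1)}(l)\,x^l$; let $\zeta$ be the Riemann zeta function; and let $(2m-1)!!=1\cdot 3\cdots(2m-1)$ with $(-1)!!=1$. Then for every natural number $n\ge 1$ the following two series converge (absolutely), and $$\sum_{k=1}^{n}\frac{1}{\sqrt{k}}=2\sqrt{n}+\zeta\left(\tfrac12\right)+\frac{1}{2\sqrt{n}}+\sum_{k=1}^{\infty}(-1)^{k+1}\frac{\sum_{l=1}^{k}(-1)^{l}\frac{(2l-1)!!}{2^{l}(l+1)!}B_{l+1}S_{k}^{(1)}(l)}{\sqrt{n}\,(n+1)(n+2)\cdots(n+k)}$$ $$=2\sqrt{n}+\zeta\left(\tfrac12\right)+\frac{1}{2\sqrt{n}}-\frac{1}{24\sqrt{n}(n+1)}-\frac{1}{24\sqrt{n}(n+1)(n+2)}-\frac{31}{384\sqrt{n}(n+1)(n+2)(n+3)}-\frac{15}{64\sqrt{n}(n+1)(n+2)(n+3)(n+4)}-\ldots$$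 and $$\sum_{k=1}^{n}\frac{1}{\sqrt{k}}=2\sqrt{n}+\zeta\left(\tfrac12\right)+\sqrt{n}\sum_{k=1}^{\infty}(-1)^{k+1}\frac{\sum_{l=1}^{k}(-1)^{l}\frac{(2l-3)!!}{2^{l-1}\,l!}B_{l}S_{k}^{(1)}(l)}{(n+1)(n+2)\cdots(n+k)}$$ $$=2\sqrt{n}+\zeta\left(\tfrac12\right)+\frac{\sqrt{n}}{2(n+1)}+\frac{11\sqrt{n}}{24(n+1)(n+2)}+\frac{7\sqrt{n}}{8(n+1)(n+2)(n+3)}+\frac{977\sqrt{n}}{384(n+1)(n+2)(n+3)(n+4)}+\ldots,$$ where the displayed terms are those of the respective series for $k=1,2,3,4$. -/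

import Mathlib

open scoped Nat

/-- The signed Stirling number of the first kind `S_k^{(1)}(l)`, obtained from Mathlib's unsigned
`Nat.stirlingFirst` by the sign `(-1)^(k+l)`. -/
def stirlingS (k l : ℕ) : ℤ := (-1) ^ (k + l) * (Nat.stirlingFirst k l : ℤ)

/-- The defining identity `(x)_k = (-1)^k ∑_{l=0}^k (-1)^l S_k^{(1)}(l) x^l`
of the signed Stirling numbers of the first kind, where `(x)_k` is the rising factorial. -/
theorem ascPochhammer_eval_eq_stirlingS (k : ℕ) (x : ℝ) :
    (ascPochhammer ℝ k).eval x =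
      (-1) ^ k * ∑ l ∈ Finset.range (k + 1), (-1) ^ l * (stirlingS k l : ℝ) * x ^ l := by
  have key : ∀ k : ℕ, (ascPochhammer ℝ k).eval x =
      ∑ l ∈ Finset.range (k + 1), (Nat.stirlingFirst k l : ℝ) * x ^ l := by
    intro k
    induction k with
    | zero => simp
    | succ k ih =>
      rw [ascPochhammer_succ_eval, ih, Finset.sum_range_succ' _ (k + 1)]
      simp only [Nat.stirlingFirst_succ_succ, Nat.stirlingFirst_succ_zero]
      push_cast
      simp only [add_mul, Finset.sum_add_distrib, mul_add]
      have h1 : ∑ l ∈ Finset.range (k + 1), (k : ℝ) * (Nat.stirlingFirst k (l + 1)) * x ^ (l + 1)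
          = (∑ l ∈ Finset.range (k + 1), (Nat.stirlingFirst k l : ℝ) * x ^ l) * k := by
        have h2 := Finset.sum_range_succ'
          (fun l => (k : ℝ) * (Nat.stirlingFirst k l : ℝ) * x ^ l) (k + 1)
        rw [Finset.sum_range_succ, Nat.stirlingFirst_eq_zero_of_lt (Nat.lt_succ_self k)] at h2
        have h3 : (k : ℝ) * (Nat.stirlingFirst k 0 : ℝ) = 0 := by
          cases k <;> simp
        rw [h3] at h2
        rw [Finset.sum_mul]
        simp only [Nat.cast_zero, mul_zero, zero_mul, add_zero] at h2
        rw [← h2]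
        exact Finset.sum_congr rfl fun l _ => by ring
      rw [h1, Finset.sum_mul]
      simp only [pow_succ, mul_assoc, Nat.cast_zero, zero_mul, add_zero]
      ring
  rw [key, Finset.mul_sum]
  refine Finset.sum_congr rfl fun l _ => ?_
  have h : ((-1 : ℝ) ^ k * (-1) ^ l) * ((-1) ^ k * (-1) ^ l) = 1 := by
    rw [← pow_add, ← pow_add]
    exact Even.neg_one_pow ⟨k + l, rfl⟩
  simp only [stirlingS, Int.cast_mul, Int.cast_pow, Int.cast_neg, Int.cast_one,
    Int.cast_natCast, pow_add]
  linear_combination (-(Nat.stirlingFirst k l : ℝ) * x ^ l) * h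

/-- `(-1)^(k+1) ∑_{l=1}^k (-1)^l (2l-1)!! / (2^l (l+1)!) B_{l+1} S_k^{(1)}(l)`.
(`bernoulli` has generating function `x / (e^x - 1)`; here `l ≥ 1`, so `2 * l - 1` does not
truncate.) -/
def invSqrtCoeff₁ (k : ℕ) : ℚ :=
  (-1) ^ (k + 1) * ∑ l ∈ Finset.Icc 1 k,
    (-1) ^ l * (((2 * l - 1)‼ : ℚ) / (2 ^ l * ((l + 1)! : ℚ))) *
      bernoulli (l + 1) * (stirlingS k l : ℚ)

/-- `(-1)^(k+1) ∑_{l=1}^k (-1)^l (2l-3)!! / (2^(l-1) l!) B_l S_k^{(1)}(l)`.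
The convention `(-1)!! = 1` applies at `l = 1`; the truncated value `0‼ = 1` agrees with it. -/
def invSqrtCoeff₂ (k : ℕ) : ℚ :=
  (-1) ^ (k + 1) * ∑ l ∈ Finset.Icc 1 k,
    (-1) ^ l * (((2 * l - 3)‼ : ℚ) / (2 ^ (l - 1) * (l ! : ℚ))) *
      bernoulli l * (stirlingS k l : ℚ)

/-- The product `(n+1)(n+2)⋯(n+k)`. -/
def shiftedRising (n k : ℕ) : ℝ := ∏ j ∈ Finset.Icc 1 k, ((n : ℝ) + (j : ℝ))

/-!
The argument works for every exponent `0 < s < 1` in place of `1 / 2`. Put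
`g(u) = 1 / u - 1 / (e ^ u - 1)`. For `1 < re s` the Mellin transforms of `e ^ (-n u) / u` and of
`e ^ (-n u) / (e ^ u - 1)` identify `∑ k ≤ n, k ^ (-s) - ζ(s) - n ^ (1 - s) / (1 - s)` with
`(1 / Γ(s)) ∫ g(u) u ^ (s - 1) e ^ (-n u) du`, and analytic continuation extends this to
`0 < re s`. If `G(t)` is the mean of `g(v t)` for a `Beta(s, 1 - s)`-distributed `v`, then the
convolution of `g(u) u ^ (s - 1)` with `u ^ (-s)` is a multiple of `G`, so the remainder equals
`n ^ (1 - s) ∫ G(t) e ^ (-n t) dt`.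

In the variable `w = 1 - e ^ (-t)` the function `-g(v t)` is a power series whose coefficients are
combinations of Bernoulli and Stirling numbers, and the Laplace transform of `w ^ k` at `n` is
`k! / (n (n + 1) ⋯ (n + k))`. Termwise integration is legitimate because all these coefficients but
the first are nonnegative for `0 < v ≤ 1`: the Riccati equation of the reciprocal of
`((1 - w) ^ (-v) - 1) / (v w)` makes the coefficients of that reciprocal monotone in `v`. The second
series arises in the same way after multiplying `G(t)` by `e ^ t = 1 / (1 - w)`, which shifts `n` to
`n + 1` and replaces the coefficients by their partial sums.
-/

section PowerSeries

open PowerSeries Finset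

/-- The formal power series `-log (1 - X)`; its constant term is the junk value `0⁻¹ = 0`. -/
noncomputable def negLogOneSub : PowerSeries ℝ := mk fun k => (k : ℝ)⁻¹

theorem constantCoeff_negLogOneSub : constantCoeff negLogOneSub = 0 := by
  rw [← coeff_zero_eq_constantCoeff_apply, negLogOneSub, coeff_mk, Nat.cast_zero, inv_zero]

theorem hasSubst_negLogOneSub : HasSubst negLogOneSub :=
  .of_constantCoeff_zero' constantCoeff_negLogOneSub

theorem one_sub_X_mul_derivative_negLogOneSub :
    (1 - X) * derivative ℝ negLogOneSub = 1 := by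
  ext k
  rw [sub_mul, one_mul, map_sub]
  cases k with
  | zero => simp [negLogOneSub, coeff_derivative]
  | succ k =>
    have h₁ : (k : ℝ) + 1 + 1 ≠ 0 := by positivity
    have h₂ : (k : ℝ) + 1 ≠ 0 := by positivity
    rw [coeff_succ_X_mul, coeff_derivative, coeff_derivative, coeff_one, if_neg k.succ_ne_zero]
    simp [negLogOneSub, h₁, h₂]

theorem coeff_negLogOneSub_pow (k l : ℕ) :
    coeff k (negLogOneSub ^ l) = (l ! : ℝ) * Nat.stirlingFirst k l / (k ! : ℝ) := by
  induction k generalizing l with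
  | zero =>
    cases l with
    | zero => simp
    | succ l => simp [constantCoeff_negLogOneSub]
  | succ k ih =>
    cases l with
    | zero => simp [coeff_one]
    | succ l =>
      have ode : (1 - X) * derivative ℝ (negLogOneSub ^ (l + 1)) =
          C ((l : ℝ) + 1) * negLogOneSub ^ l := by
        have h := one_sub_X_mul_derivative_negLogOneSub
        rw [derivative_pow, Nat.add_sub_cancel]
        push_cast
        rw [map_add, map_natCast, map_one]
        linear_combination ((l : PowerSeries ℝ) + 1) * negLogOneSub ^ l * h
      have key := congrArg (coeff k) ode
      have hX : coeff k (X * derivative ℝ (negLogOneSub ^ (l + 1))) =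
          k * coeff k (negLogOneSub ^ (l + 1)) := by
        cases k with
        | zero => simp
        | succ k => rw [coeff_succ_X_mul, coeff_derivative]; push_cast; ring
      rw [sub_mul, one_mul, map_sub, coeff_derivative, hX, coeff_C_mul, ih, ih] at key
      have hk : ((k : ℝ) + 1) ≠ 0 := by positivity
      rw [← mul_left_inj' hk, eq_add_of_sub_eq key, Nat.stirlingFirst_succ_succ,
        Nat.factorial_succ, Nat.factorial_succ]
      push_cast
      field_simp
      ring

theorem coeff_subst_negLogOneSub (F : PowerSeries ℝ) (k : ℕ) :
    coeff k (F.subst negLogOneSub) =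
      (∑ l ∈ range (k + 1), (Nat.stirlingFirst k l : ℝ) * ((l ! : ℝ) * coeff l F)) / (k ! : ℝ) := by
  rw [coeff_subst' hasSubst_negLogOneSub, finsum_eq_sum_of_support_subset (s := range (k + 1)),
    sum_div]
  · refine sum_congr rfl fun l _ => ?_
    rw [coeff_negLogOneSub_pow, smul_eq_mul]
    ring
  · intro l hl
    by_contra h
    refine hl ?_
    simp [coeff_negLogOneSub_pow, Nat.stirlingFirst_eq_zero_of_lt (by simpa using h : k < l)]

/-- The formal power series `(1 - X) ^ (-v)`. -/
noncomputable def oneSubPowNeg (v : ℝ) : PowerSeries ℝ :=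
  mk fun k => (ascPochhammer ℝ k).eval v / (k ! : ℝ)

theorem subst_rescale_exp (v : ℝ) :
    (rescale v (exp ℝ)).subst negLogOneSub = oneSubPowNeg v := by
  ext k
  rw [coeff_subst_negLogOneSub, oneSubPowNeg, coeff_mk, ascPochhammer_eval_eq_stirlingS, mul_sum]
  congr 1
  refine sum_congr rfl fun l _ => ?_
  have hsign : ((-1 : ℝ) ^ k * (-1) ^ l) * ((-1) ^ k * (-1) ^ l) = 1 := by
    rw [← pow_add, ← pow_add]
    exact Even.neg_one_pow ⟨k + l, rfl⟩
  have hl : (l ! : ℝ) ≠ 0 := by positivity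
  simp only [coeff_rescale, coeff_exp, stirlingS, pow_add]
  push_cast
  field_simp
  linear_combination (-(Nat.stirlingFirst k l : ℝ) * v ^ l) * hsign

/-- The formal power series `((1 - X) ^ (-v) - 1) / (v X)`, read as `-log (1 - X) / X` when
`v = 0`. -/
noncomputable def powQuot (v : ℝ) : PowerSeries ℝ :=
  mk fun k => (ascPochhammer ℝ k).eval (v + 1) / ((k + 1)! : ℝ)

theorem ascPochhammer_eval_succ_left (x : ℝ) (k : ℕ) :
    (ascPochhammer ℝ (k + 1)).eval x = x * (ascPochhammer ℝ k).eval (x + 1) := by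
  simp [ascPochhammer_succ_left, Polynomial.eval_comp]

theorem oneSubPowNeg_sub_one (v : ℝ) : oneSubPowNeg v - 1 = C v * (X * powQuot v) := by
  ext k
  cases k with
  | zero => simp [oneSubPowNeg]
  | succ k =>
    rw [map_sub, coeff_C_mul, coeff_succ_X_mul, coeff_one, if_neg k.succ_ne_zero]
    simp [oneSubPowNeg, powQuot, ascPochhammer_eval_succ_left, mul_div_assoc]

theorem coeff_powQuot_zero (k : ℕ) : coeff k (powQuot 0) = ((k : ℝ) + 1)⁻¹ := by
  have : (k ! : ℝ) ≠ 0 := by positivity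
  rw [powQuot, coeff_mk, zero_add, ascPochhammer_eval_one, Nat.factorial_succ]
  push_cast
  field_simp

theorem X_mul_powQuot_zero : X * powQuot 0 = negLogOneSub := by
  ext k
  cases k with
  | zero => simp [negLogOneSub]
  | succ k => rw [coeff_succ_X_mul, coeff_powQuot_zero]; simp [negLogOneSub]

theorem powQuot_ode (v : ℝ) :
    (1 - X) * (powQuot v + X * derivative ℝ (powQuot v)) = 1 + C v * X * powQuot v := by
  ext k
  have hX (k : ℕ) : coeff k (powQuot v + X * derivative ℝ (powQuot v)) =
      (k + 1) * coeff k (powQuot v) := by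
    cases k with
    | zero => simp
    | succ k => rw [map_add, coeff_succ_X_mul, coeff_derivative]; push_cast; ring
  rw [sub_mul, one_mul, map_sub, hX, map_add, mul_assoc, coeff_C_mul]
  cases k with
  | zero => simp [powQuot]
  | succ k =>
    rw [coeff_succ_X_mul, coeff_succ_X_mul, hX, coeff_one, if_neg k.succ_ne_zero, powQuot,
      coeff_mk, coeff_mk, ascPochhammer_succ_eval, Nat.factorial_succ (k + 1)]
    push_cast
    field_simp
    ring

theorem constantCoeff_powQuot (v : ℝ) : constantCoeff (powQuot v) = 1 := by
  rw [← coeff_zero_eq_constantCoeff_apply]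
  simp [powQuot]

theorem powQuot_inv_mul (v : ℝ) : (powQuot v)⁻¹ * powQuot v = 1 :=
  PowerSeries.inv_mul_cancel _ (by rw [constantCoeff_powQuot]; exact one_ne_zero)

theorem powQuot_inv_riccati (v : ℝ) :
    (1 - X) * ((powQuot v)⁻¹ - X * derivative ℝ (powQuot v)⁻¹) =
      (powQuot v)⁻¹ ^ 2 + C v * X * (powQuot v)⁻¹ := by
  have hinv := powQuot_inv_mul v
  rw [derivative_inv']
  linear_combination (powQuot v)⁻¹ ^ 2 * powQuot_ode v +
    (C v * X * (powQuot v)⁻¹ - (1 - X) * (powQuot v)⁻¹) * hinv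

/-- The part of `1 - (powQuot v)⁻¹` of order at least two. -/
noncomputable def powQuotRem (v : ℝ) : PowerSeries ℝ :=
  1 - C ((1 + v) / 2) * X - (powQuot v)⁻¹

theorem powQuotRem_ode (v : ℝ) :
    powQuotRem v + X * derivative ℝ (powQuotRem v) =
      X * (X * derivative ℝ (powQuotRem v)) + powQuotRem v ^ 2 + C ((1 - v ^ 2) / 4) * X ^ 2 := by
  have hinv : (powQuot v)⁻¹ = 1 - C ((1 + v) / 2) * X - powQuotRem v := by
    rw [powQuotRem]; ring
  have hder : derivative ℝ (powQuot v)⁻¹ = -C ((1 + v) / 2) - derivative ℝ (powQuotRem v) := by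
    simp [hinv]
  have riccati := powQuot_inv_riccati v
  rw [hder, hinv] at riccati
  have hsq : C ((1 - v ^ 2) / 4) = C ((1 + v) / 2) * (C ((1 + v) / 2) - C v) := by
    rw [← map_sub, ← map_mul]; congr 1; ring
  have htwo : C ((1 + v) / 2) * 2 = 1 + C v := by
    rw [← map_ofNat C 2, ← map_mul, ← map_one C, ← map_add]; congr 1; ring
  rw [hsq]
  linear_combination riccati + (X * powQuotRem v - X) * htwo

theorem coeff_zero_powQuotRem (v : ℝ) : coeff 0 (powQuotRem v) = 0 := by
  simp [powQuotRem, constantCoeff_powQuot]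

theorem coeff_succ_powQuotRem (v : ℝ) (k : ℕ) :
    ((k : ℝ) + 2) * coeff (k + 1) (powQuotRem v) =
      k * coeff k (powQuotRem v) +
        ∑ p ∈ antidiagonal (k + 1), coeff p.1 (powQuotRem v) * coeff p.2 (powQuotRem v) +
        if k = 1 then (1 - v ^ 2) / 4 else 0 := by
  have h := congrArg (coeff (k + 1)) (powQuotRem_ode v)
  have hX : coeff k (X * derivative ℝ (powQuotRem v)) = k * coeff k (powQuotRem v) := by
    cases k with
    | zero => simp
    | succ k => rw [coeff_succ_X_mul, coeff_derivative]; push_cast; ring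
  rw [map_add, map_add, map_add, coeff_succ_X_mul, coeff_succ_X_mul, hX, coeff_derivative,
    coeff_C_mul, coeff_X_pow, sq, coeff_mul (k + 1)] at h
  simp only [show k + 1 = 2 ↔ k = 1 by omega, mul_ite, mul_one, mul_zero] at h
  linear_combination h

theorem coeff_one_powQuotRem (v : ℝ) : coeff 1 (powQuotRem v) = 0 := by
  have h := coeff_succ_powQuotRem v 0
  rw [zero_add, Nat.sum_antidiagonal_succ, coeff_zero_powQuotRem] at h
  simpa [coeff_zero_powQuotRem] using h

theorem coeff_add_two_powQuotRem (v : ℝ) (k : ℕ) :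
    ((k : ℝ) + 3) * coeff (k + 2) (powQuotRem v) =
      (k + 1) * coeff (k + 1) (powQuotRem v) +
        ∑ p ∈ antidiagonal k, coeff (p.1 + 1) (powQuotRem v) * coeff (p.2 + 1) (powQuotRem v) +
        if k = 0 then (1 - v ^ 2) / 4 else 0 := by
  have h := coeff_succ_powQuotRem v (k + 1)
  rw [Nat.sum_antidiagonal_succ, Nat.sum_antidiagonal_succ', coeff_zero_powQuotRem] at h
  simp only [zero_mul, mul_zero, zero_add, add_eq_right] at h
  push_cast at h
  linear_combination h

theorem coeff_powQuotRem_nonneg_antitone {u v : ℝ} (hu : 0 ≤ u) (huv : u ≤ v) (hv : v ≤ 1)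
    (k : ℕ) : 0 ≤ coeff k (powQuotRem v) ∧ coeff k (powQuotRem v) ≤ coeff k (powQuotRem u) := by
  induction k using Nat.strong_induction_on with
  | _ k ih =>
    match k with
    | 0 => simp only [coeff_zero_powQuotRem, le_refl, and_self]
    | 1 => simp only [coeff_one_powQuotRem, le_refl, and_self]
    | k + 2 =>
      have hprev := ih (k + 1) (by omega)
      have hconv : 0 ≤ ∑ p ∈ antidiagonal k,
          coeff (p.1 + 1) (powQuotRem v) * coeff (p.2 + 1) (powQuotRem v) :=
        sum_nonneg fun p hp => by
          have := mem_antidiagonal.mp hp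
          exact mul_nonneg (ih _ (by omega)).1 (ih _ (by omega)).1
      have hconv_le : ∑ p ∈ antidiagonal k,
            coeff (p.1 + 1) (powQuotRem v) * coeff (p.2 + 1) (powQuotRem v) ≤
          ∑ p ∈ antidiagonal k,
            coeff (p.1 + 1) (powQuotRem u) * coeff (p.2 + 1) (powQuotRem u) :=
        sum_le_sum fun p hp => by
          have := mem_antidiagonal.mp hp
          have h₁ := ih (p.1 + 1) (by omega)
          have h₂ := ih (p.2 + 1) (by omega)
          exact mul_le_mul h₁.2 h₂.2 h₂.1 (h₁.1.trans h₁.2)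
      have hsq : 0 ≤ (if k = 0 then (1 - v ^ 2) / 4 else 0) ∧
          (if k = 0 then (1 - v ^ 2) / 4 else 0) ≤ if k = 0 then (1 - u ^ 2) / 4 else 0 := by
        split_ifs
        · constructor <;> nlinarith
        · exact ⟨le_rfl, le_rfl⟩
      have hk : (0 : ℝ) < k + 3 := by positivity
      have hnonneg := mul_nonneg (by positivity : (0 : ℝ) ≤ k + 1) hprev.1
      have hle := mul_le_mul_of_nonneg_left hprev.2 (by positivity : (0 : ℝ) ≤ k + 1)
      constructor
      · refine nonneg_of_mul_nonneg_right ?_ hk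
        rw [coeff_add_two_powQuotRem]
        linarith
      · refine le_of_mul_le_mul_left ?_ hk
        rw [coeff_add_two_powQuotRem, coeff_add_two_powQuotRem]
        linarith

theorem coeff_powQuotRem_zero_le_one (k : ℕ) : coeff k (powQuotRem 0) ≤ 1 := by
  obtain _ | k := k
  · simp [coeff_zero_powQuotRem]
  have hrem (j) : 0 ≤ coeff j (powQuotRem 0) :=
    (coeff_powQuotRem_nonneg_antitone le_rfl le_rfl zero_le_one j).1
  have hexp : powQuotRem 0 * powQuot 0 + C (1 / 2) * (X * powQuot 0) = powQuot 0 - 1 := by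
    rw [powQuotRem, add_zero]
    linear_combination -powQuot_inv_mul 0
  have h := congrArg (coeff (k + 1)) hexp
  have hquot (j : ℕ) : 0 ≤ coeff j (powQuot 0) := by rw [coeff_powQuot_zero]; positivity
  rw [map_add, map_sub, coeff_C_mul, coeff_succ_X_mul, coeff_one, if_neg k.succ_ne_zero, sub_zero,
    coeff_mul] at h
  have hle := single_le_sum
    (f := fun p : ℕ × ℕ => coeff p.1 (powQuotRem 0) * coeff p.2 (powQuot 0))
    (fun p _ => mul_nonneg (hrem p.1) (hquot p.2))
    (mem_antidiagonal.mpr (show (k + 1, 0).1 + (k + 1, 0).2 = k + 1 from rfl))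
  have hone : coeff (k + 1) (powQuot 0) ≤ 1 := by
    rw [coeff_powQuot_zero]
    exact inv_le_one_of_one_le₀ (by push_cast; linarith [k.cast_nonneg (α := ℝ)])
  rw [coeff_zero_eq_constantCoeff_apply, constantCoeff_powQuot, mul_one] at hle
  linarith [hquot k]

/-- The coefficient of `(1 - e ^ (-t)) ^ k` in the expansion of `1 / (e ^ (v t) - 1) - 1 / (v t)`,
a polynomial in `v`. -/
noncomputable def bernoulliGapCoeff (k : ℕ) (v : ℝ) : ℝ :=
  (∑ l ∈ range (k + 1), (Nat.stirlingFirst k l : ℝ) * ((bernoulli (l + 1) : ℝ) / (l + 1) * v ^ l)) /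
    (k ! : ℝ)

theorem one_add_mul_bernoulliGapCoeff (v : ℝ) (hv : v ≠ 0) :
    (1 + C v * negLogOneSub * mk fun k => bernoulliGapCoeff k v) * (oneSubPowNeg v - 1) =
      C v * negLogOneSub := by
  set F : PowerSeries ℝ := mk fun l => (bernoulli (l + 1) : ℝ) / (l + 1)! * v ^ l with hF
  have hgap : (mk fun k => bernoulliGapCoeff k v) = F.subst negLogOneSub := by
    ext k
    rw [coeff_mk, coeff_subst_negLogOneSub, bernoulliGapCoeff]
    congr 1
    refine sum_congr rfl fun l _ => ?_
    rw [hF, coeff_mk, Nat.factorial_succ]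
    push_cast
    field_simp
  have hB : rescale v (bernoulliPowerSeries ℝ) = 1 + C v * X * F := by
    ext l
    rw [mul_assoc, map_add, coeff_C_mul]
    cases l with
    | zero => simp [bernoulliPowerSeries]
    | succ l =>
      rw [coeff_succ_X_mul, coeff_one, if_neg l.succ_ne_zero]
      simp [bernoulliPowerSeries, hF]
      ring
  have hC : substAlgHom hasSubst_negLogOneSub (C v) = C v := AlgHom.commutes _ v
  have h := congrArg (substAlgHom hasSubst_negLogOneSub ∘ rescale v)
    (bernoulliPowerSeries_mul_exp_sub_one ℝ)
  simp only [Function.comp_apply, map_mul, map_sub, map_one, map_add, hB, rescale_X, hC,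
    substAlgHom_X] at h
  rwa [coe_substAlgHom, subst_rescale_exp, ← hgap] at h

theorem mul_bernoulliGapCoeff_succ {v : ℝ} (hv : v ≠ 0) (k : ℕ) :
    v * bernoulliGapCoeff (k + 1) v =
      coeff (k + 2) (powQuotRem 0) - coeff (k + 2) (powQuotRem v) := by
  have hgen := one_add_mul_bernoulliGapCoeff v hv
  set G : PowerSeries ℝ := mk fun k => bernoulliGapCoeff k v with hG
  have hcancel : (1 + C v * (X * powQuot 0) * G) * powQuot v = powQuot 0 := by
    have hvX : C v * X ≠ (0 : PowerSeries ℝ) :=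
      mul_ne_zero (by simpa using hv) X_ne_zero
    refine mul_left_cancel₀ hvX ?_
    rw [oneSubPowNeg_sub_one, ← X_mul_powQuot_zero] at hgen
    linear_combination hgen
  have hdiff : C v * (X * G) = (powQuot v)⁻¹ - (powQuot 0)⁻¹ := by
    linear_combination (powQuot 0)⁻¹ * (powQuot v)⁻¹ * hcancel +
      ((powQuot v)⁻¹ - C v * X * G) * powQuot_inv_mul 0 -
      ((powQuot 0)⁻¹ + C v * (X * powQuot 0) * G * (powQuot 0)⁻¹) * powQuot_inv_mul v
  have h := congrArg (coeff (k + 2)) hdiff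
  have hrem (u : ℝ) : coeff (k + 2) (powQuotRem u) = -coeff (k + 2) (powQuot u)⁻¹ := by
    simp [powQuotRem, coeff_one]
  rw [coeff_C_mul, coeff_succ_X_mul, hG, coeff_mk, map_sub] at h
  rw [h, hrem, hrem]
  ring

end PowerSeries

section Expansion

open PowerSeries Finset Filter Topology Real

/-- The power series `f` converges at `w`, with sum `a`. -/
def HasValueAt (f : PowerSeries ℝ) (w a : ℝ) : Prop :=
  HasSum (fun k => coeff k f * w ^ k) a

namespace HasValueAt

variable {f g : PowerSeries ℝ} {w a b : ℝ}

theorem const (c w : ℝ) : HasValueAt (C c) w c := by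
  unfold HasValueAt
  convert! hasSum_ite_eq 0 c using 2 with k
  rw [coeff_C]
  split_ifs with hk <;> simp [hk]

theorem one (w : ℝ) : HasValueAt 1 w 1 := by
  simpa using const 1 w

theorem add (hf : HasValueAt f w a) (hg : HasValueAt g w b) : HasValueAt (f + g) w (a + b) := by
  simpa only [HasValueAt, map_add, add_mul] using HasSum.add hf hg

theorem sub (hf : HasValueAt f w a) (hg : HasValueAt g w b) : HasValueAt (f - g) w (a - b) := by
  simpa only [HasValueAt, map_sub, sub_mul] using HasSum.sub hf hg

theorem mul (hf : HasValueAt f w a) (hg : HasValueAt g w b) : HasValueAt (f * g) w (a * b) := by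
  have hcauchy (k : ℕ) : ∑ p ∈ antidiagonal k,
      coeff p.1 f * w ^ p.1 * (coeff p.2 g * w ^ p.2) = coeff k (f * g) * w ^ k := by
    rw [coeff_mul, sum_mul]
    refine sum_congr rfl fun p hp => ?_
    rw [← mem_antidiagonal.mp hp, pow_add]
    ring
  have hf' := (HasSum.summable hf).norm
  have hg' := (HasSum.summable hg).norm
  have hsum := summable_norm_sum_mul_antidiagonal_of_summable_norm hf' hg'
  have htsum := tsum_mul_tsum_eq_tsum_sum_antidiagonal_of_summable_norm hf' hg'
  simp only [hcauchy] at hsum htsum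
  rw [HasValueAt, ← HasSum.tsum_eq hf, ← HasSum.tsum_eq hg, htsum]
  exact hsum.of_norm.hasSum

end HasValueAt

theorem hasValueAt_oneSubPowNeg (v : ℝ) {w : ℝ} (hw : |w| < 1) :
    HasValueAt (oneSubPowNeg v) w (1 / (1 - w) ^ v) := by
  have h := (one_div_one_sub_rpow_hasFPowerSeriesOnBall_zero v).hasSum (y := w)
    (by simpa [Metric.mem_eball, edist_zero_right, ← ofReal_norm] using hw)
  rw [zero_add] at h
  refine h.congr_fun fun k => ?_
  have hchoose := Ring.factorial_nsmul_multichoose_eq_ascPochhammer v k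
  rw [nsmul_eq_mul, Polynomial.ascPochhammer_smeval_eq_eval] at hchoose
  rw [FormalMultilinearSeries.ofScalars_apply_eq, smul_eq_mul, oneSubPowNeg, coeff_mk, Ring.choose,
    show v + k - 1 - k + 1 = v by ring, ← hchoose, mul_div_cancel_left₀ _ (by positivity)]

theorem hasValueAt_negLogOneSub {w : ℝ} (hw : |w| < 1) :
    HasValueAt negLogOneSub w (-log (1 - w)) := by
  rw [HasValueAt, ← hasSum_nat_add_iff' 1]
  simpa [negLogOneSub, div_eq_inv_mul] using hasSum_pow_div_log_of_abs_lt_one hw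

/-- The function `1 / u - 1 / (e ^ u - 1)`, i.e. `(1 - ∑ B_m u ^ m / m!) / u`; it is positive and
takes the junk value `0` at `u = 0`, where it has a removable singularity. -/
noncomputable def bernoulliGap (u : ℝ) : ℝ := 1 / u - 1 / (exp u - 1)

theorem bernoulliGap_nonneg {u : ℝ} (hu : 0 ≤ u) : 0 ≤ bernoulliGap u := by
  rcases hu.eq_or_lt with rfl | hu
  · simp [bernoulliGap]
  · exact sub_nonneg.mpr (one_div_le_one_div_of_le hu (by linarith [add_one_le_exp u]))

theorem bernoulliGap_le_one {u : ℝ} (hu : 0 ≤ u) : bernoulliGap u ≤ 1 := by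
  rcases hu.eq_or_lt with rfl | hu
  · simp [bernoulliGap]
  have hexp : 0 < exp u - 1 := by linarith [add_one_lt_exp hu.ne']
  have h : exp u - 1 ≤ u * exp u := by
    have := mul_le_mul_of_nonneg_left (one_sub_le_exp_neg u) (exp_pos u).le
    rw [← exp_add, add_neg_cancel, exp_zero] at this
    linarith
  rw [bernoulliGap, div_sub_div _ _ hu.ne' hexp.ne', div_le_one (by positivity)]
  linarith

theorem measurable_bernoulliGap : Measurable bernoulliGap := by
  unfold bernoulliGap
  fun_prop

theorem bernoulliGapCoeff_succ_nonneg {v : ℝ} (hv : 0 < v) (hv1 : v ≤ 1) (k : ℕ) :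
    0 ≤ bernoulliGapCoeff (k + 1) v := by
  have hle := (coeff_powQuotRem_nonneg_antitone le_rfl hv.le hv1 (k + 2)).2
  refine nonneg_of_mul_nonneg_right ?_ hv
  rw [mul_bernoulliGapCoeff_succ hv.ne']
  linarith

theorem summable_bernoulliGapCoeff {v w : ℝ} (hv : 0 < v) (hv1 : v ≤ 1) (hw : 0 ≤ w)
    (hw1 : w < 1) : Summable fun k => bernoulliGapCoeff k v * w ^ k := by
  rw [← summable_nat_add_iff 1]
  refine Summable.of_nonneg_of_le
    (fun k => mul_nonneg (bernoulliGapCoeff_succ_nonneg hv hv1 k) (pow_nonneg hw _)) (fun k => ?_)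
    (((summable_nat_add_iff 1).mpr (summable_geometric_of_lt_one hw hw1)).mul_left v⁻¹)
  refine mul_le_mul_of_nonneg_right ?_ (pow_nonneg hw _)
  rw [← one_div, le_div_iff₀ hv, mul_comm, mul_bernoulliGapCoeff_succ hv.ne']
  linarith [coeff_powQuotRem_zero_le_one (k + 2),
    (coeff_powQuotRem_nonneg_antitone le_rfl hv.le hv1 (k + 2)).1]

theorem hasSum_bernoulliGapCoeff {v t : ℝ} (hv : 0 < v) (hv1 : v ≤ 1) (ht : 0 < t) :
    HasSum (fun k => bernoulliGapCoeff k v * (1 - exp (-t)) ^ k) (-bernoulliGap (v * t)) := by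
  set w := 1 - exp (-t) with hw
  have hw0 : 0 < w := by rw [hw, sub_pos, exp_lt_one_iff]; linarith
  have hw1 : w < 1 := by linarith [exp_pos (-t)]
  have habs : |w| < 1 := by rwa [abs_of_pos hw0]
  have hlog : -log (1 - w) = t := by simp [hw]
  have hpow : 1 / (1 - w) ^ v = exp (v * t) := by
    rw [hw, sub_sub_cancel, ← exp_mul, one_div, ← exp_neg]
    ring_nf
  obtain ⟨S, hS⟩ := summable_bernoulliGapCoeff hv hv1 hw0.le hw1
  have hG : HasValueAt (mk fun k => bernoulliGapCoeff k v) w S := by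
    simpa only [HasValueAt, coeff_mk] using hS
  have hL := (HasValueAt.const v w).mul (hlog ▸ hasValueAt_negLogOneSub habs)
  have hE := (hpow ▸ hasValueAt_oneSubPowNeg v habs).sub (HasValueAt.one w)
  have hprod := ((HasValueAt.one w).add (hL.mul hG)).mul hE
  rw [one_add_mul_bernoulliGapCoeff v hv.ne'] at hprod
  have hval := HasSum.unique hprod hL
  have hexp : exp (v * t) - 1 ≠ 0 := by
    have := add_one_lt_exp (mul_pos hv ht).ne'
    nlinarith [mul_pos hv ht]
  convert! hS using 1
  rw [bernoulliGap]
  field_simp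
  linarith

theorem sum_range_bernoulliGapCoeff_nonpos {v : ℝ} (hv : 0 < v) (hv1 : v ≤ 1) (n : ℕ) :
    ∑ k ∈ range (n + 1), bernoulliGapCoeff k v ≤ 0 := by
  have hlim : Tendsto (fun t => ∑ k ∈ range (n + 1), bernoulliGapCoeff k v * (1 - exp (-t)) ^ k)
      atTop (𝓝 (∑ k ∈ range (n + 1), bernoulliGapCoeff k v * (1 - 0) ^ k)) :=
    tendsto_finsetSum _ fun k _ =>
      ((tendsto_const_nhds.sub tendsto_exp_neg_atTop_nhds_zero).pow k).const_mul _
  simp only [sub_zero, one_pow, mul_one] at hlim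
  refine le_of_tendsto hlim ((eventually_gt_atTop 0).mono fun t ht => ?_)
  refine (sum_le_hasSum _ (fun k hk => ?_) (hasSum_bernoulliGapCoeff hv hv1 ht)).trans
    (neg_nonpos.mpr (bernoulliGap_nonneg (by positivity)))
  obtain ⟨k, rfl⟩ := Nat.exists_eq_succ_of_ne_zero (n := k) (by rintro rfl; simp at hk)
  exact mul_nonneg (bernoulliGapCoeff_succ_nonneg hv hv1 k)
    (pow_nonneg (sub_nonneg.mpr (exp_le_one_iff.mpr (by linarith))) _)

end Expansion

section BetaMixture

open PowerSeries Finset Real MeasureTheory ProbabilityTheory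

theorem ae_betaMeasure_mem_Ioo (α β : ℝ) : ∀ᵐ v ∂betaMeasure α β, v ∈ Set.Ioo 0 1 := by
  have hmeas : Measurable (betaPDF α β) := (measurable_betaPDFReal α β).ennreal_ofReal
  refine (ae_withDensity_iff hmeas).mpr (ae_of_all _ fun v hv => ?_)
  by_contra hnot
  rw [Set.mem_Ioo] at hnot
  exact hv ((betaPDF_eq α β v).trans (by rw [if_neg hnot, ENNReal.ofReal_zero]))

theorem betaPDFReal_nonneg {α β : ℝ} (hα : 0 < α) (hβ : 0 < β) (v : ℝ) :
    0 ≤ betaPDFReal α β v := by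
  by_cases hv : 0 < v ∧ v < 1
  · exact (betaPDFReal_pos hv.1 hv.2 hα hβ).le
  · rw [betaPDFReal, if_neg hv]

theorem integral_betaMeasure {α β : ℝ} (hα : 0 < α) (hβ : 0 < β) (f : ℝ → ℝ) :
    ∫ v, f v ∂betaMeasure α β = ∫ v, betaPDFReal α β v * f v := by
  have hmeas : Measurable (betaPDF α β) := (measurable_betaPDFReal α β).ennreal_ofReal
  rw [betaMeasure, integral_withDensity_eq_integral_toReal_smul hmeas
    (ae_of_all _ fun _ => ENNReal.ofReal_lt_top)]
  simp only [betaPDF, ENNReal.toReal_ofReal (betaPDFReal_nonneg hα hβ _), smul_eq_mul]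

theorem Gamma_add_nat {s : ℝ} (hs : 0 < s) (l : ℕ) :
    Gamma (s + l) = (ascPochhammer ℝ l).eval s * Gamma s := by
  induction l with
  | zero => simp
  | succ l ih =>
    rw [Nat.cast_succ, ← add_assoc, Gamma_add_one (by positivity), ih, ascPochhammer_succ_eval]
    ring

theorem beta_add_nat {α β : ℝ} (hα : 0 < α) (hβ : 0 < β) (l : ℕ) :
    beta (α + l) β =
      (ascPochhammer ℝ l).eval α / (ascPochhammer ℝ l).eval (α + β) * beta α β := by
  rw [beta, beta, add_right_comm, Gamma_add_nat hα, Gamma_add_nat (add_pos hα hβ), mul_assoc,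
    div_mul_div_comm]

theorem betaPDFReal_mul_pow {α β : ℝ} (hα : 0 < α) (hβ : 0 < β) (l : ℕ) (v : ℝ) :
    betaPDFReal α β v * v ^ l =
      (ascPochhammer ℝ l).eval α / (ascPochhammer ℝ l).eval (α + β) *
        betaPDFReal (α + l) β v := by
  by_cases hv : 0 < v ∧ v < 1
  · have hbeta := beta_add_nat hα hβ l
    have hpos := beta_pos hα hβ
    have hpos' := beta_pos (add_pos_of_pos_of_nonneg hα l.cast_nonneg) hβ
    rw [betaPDFReal, betaPDFReal, if_pos hv, if_pos hv, add_sub_right_comm,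
      rpow_add hv.1, rpow_natCast]
    field_simp
    linear_combination v ^ (α - 1) * (1 - v) ^ (β - 1) * v ^ l * hbeta
  · rw [betaPDFReal, betaPDFReal, if_neg hv, if_neg hv, zero_mul, mul_zero]

theorem integral_pow_betaMeasure {α β : ℝ} (hα : 0 < α) (hβ : 0 < β) (l : ℕ) :
    ∫ v, v ^ l ∂betaMeasure α β =
      (ascPochhammer ℝ l).eval α / (ascPochhammer ℝ l).eval (α + β) := by
  have hαl : 0 < α + l := add_pos_of_pos_of_nonneg hα l.cast_nonneg
  have := isProbabilityMeasureBeta hαl hβ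
  have hone := integral_betaMeasure hαl hβ fun _ => 1
  simp only [integral_const, probReal_univ, smul_eq_mul, mul_one] at hone
  simp only [integral_betaMeasure hα hβ, betaPDFReal_mul_pow hα hβ, integral_const_mul, ← hone,
    mul_one]

/-- The coefficient of `1 / (n ^ s (n + 1) ⋯ (n + k))` in the first inverse factorial series for
`∑ j ∈ Icc 1 n, j ^ (-s)`, with the term `1 / (2 n ^ s)` included as the case `k = 0`. It
generalizes `invSqrtCoeff₁` to the exponent `s`. -/
noncomputable def rpowSumCoeff₁ (s : ℝ) (k : ℕ) : ℝ :=
  -∑ l ∈ range (k + 1), (Nat.stirlingFirst k l : ℝ) *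
    ((bernoulli (l + 1) : ℝ) / (l + 1)! * (ascPochhammer ℝ l).eval s)

/-- The coefficient of `n ^ (1 - s) / ((n + 1) ⋯ (n + k))` in the second inverse factorial series
for `∑ j ∈ Icc 1 n, j ^ (-s)`. It generalizes `invSqrtCoeff₂` to the exponent `s`; the summation
index is one less than in the classical formula. -/
noncomputable def rpowSumCoeff₂ (s : ℝ) (k : ℕ) : ℝ :=
  -∑ l ∈ range k, (Nat.stirlingFirst k (l + 1) : ℝ) *
    ((bernoulli (l + 1) : ℝ) / (l + 1)! * (ascPochhammer ℝ l).eval s)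

theorem rpowSumCoeff₁_zero (s : ℝ) : rpowSumCoeff₁ s 0 = 1 / 2 := by
  norm_num [rpowSumCoeff₁, bernoulli_one]

theorem rpowSumCoeff₂_succ (s : ℝ) (k : ℕ) :
    rpowSumCoeff₂ s (k + 1) = k * rpowSumCoeff₂ s k + rpowSumCoeff₁ s k := by
  have hsplit (l : ℕ) : (Nat.stirlingFirst (k + 1) (l + 1) : ℝ) =
      k * Nat.stirlingFirst k (l + 1) + Nat.stirlingFirst k l := by
    exact_mod_cast Nat.stirlingFirst_succ_succ k l
  rw [rpowSumCoeff₂, rpowSumCoeff₂, rpowSumCoeff₁]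
  simp only [hsplit, add_mul, sum_add_distrib, mul_assoc, ← mul_sum]
  rw [sum_range_succ (fun l => (Nat.stirlingFirst k (l + 1) : ℝ) * _),
    Nat.stirlingFirst_eq_zero_of_lt k.lt_succ_self]
  simp only [Nat.cast_zero]
  ring

theorem rpowSumCoeff₂_succ_eq_sum (s : ℝ) (k : ℕ) :
    rpowSumCoeff₂ s (k + 1) / k ! = ∑ j ∈ range (k + 1), rpowSumCoeff₁ s j / j ! := by
  induction k with
  | zero => simp [rpowSumCoeff₂_succ]
  | succ k ih =>
    rw [sum_range_succ, ← ih, rpowSumCoeff₂_succ, Nat.factorial_succ]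
    push_cast
    field_simp

/-- The average of `bernoulliGap (v * t)` over a random `v` with the beta distribution of
parameters `s` and `1 - s`. -/
noncomputable def bernoulliGapMean (s t : ℝ) : ℝ :=
  ∫ v, bernoulliGap (v * t) ∂betaMeasure s (1 - s)

section Exponent

variable {s : ℝ} (hs : 0 < s) (hs1 : s < 1)
include hs hs1

theorem integrable_pow_betaMeasure (l : ℕ) :
    Integrable (fun v : ℝ => v ^ l) (betaMeasure s (1 - s)) := by
  have := isProbabilityMeasureBeta hs (sub_pos.mpr hs1)
  refine .of_bound (measurable_id.pow_const l).aestronglyMeasurable 1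
    ((ae_betaMeasure_mem_Ioo _ _).mono fun v hv => ?_)
  simpa [abs_of_pos hv.1] using pow_le_one₀ hv.1.le hv.2.le

theorem integrable_bernoulliGapCoeff (k : ℕ) :
    Integrable (bernoulliGapCoeff k) (betaMeasure s (1 - s)) :=
  (integrable_finsetSum _ fun l _ =>
    ((integrable_pow_betaMeasure hs hs1 l).const_mul _).const_mul _).div_const _

theorem integral_bernoulliGapCoeff (k : ℕ) :
    ∫ v, bernoulliGapCoeff k v ∂betaMeasure s (1 - s) = -(rpowSumCoeff₁ s k / k !) := by
  simp only [bernoulliGapCoeff, integral_div]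
  rw [integral_finsetSum _ fun l _ =>
    ((integrable_pow_betaMeasure hs hs1 l).const_mul _).const_mul _]
  simp only [integral_const_mul, integral_pow_betaMeasure hs (sub_pos.mpr hs1),
    add_sub_cancel, ascPochhammer_eval_one, rpowSumCoeff₁, neg_div, neg_neg, Nat.factorial_succ]
  congr 1
  refine sum_congr rfl fun l _ => ?_
  push_cast
  field_simp

theorem rpowSumCoeff₁_succ_nonpos (k : ℕ) : rpowSumCoeff₁ s (k + 1) ≤ 0 := by
  have hint : 0 ≤ ∫ v, bernoulliGapCoeff (k + 1) v ∂betaMeasure s (1 - s) :=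
    integral_nonneg_of_ae ((ae_betaMeasure_mem_Ioo _ _).mono fun v hv =>
      bernoulliGapCoeff_succ_nonneg hv.1 hv.2.le k)
  rw [integral_bernoulliGapCoeff hs hs1, neg_nonneg] at hint
  exact nonpos_of_mul_nonpos_left (div_eq_mul_inv (rpowSumCoeff₁ s _) _ ▸ hint) (by positivity)

theorem rpowSumCoeff₂_nonneg (k : ℕ) : 0 ≤ rpowSumCoeff₂ s k := by
  rcases k with _ | k
  · simp [rpowSumCoeff₂]
  have hint : ∫ v, ∑ j ∈ range (k + 1), bernoulliGapCoeff j v ∂betaMeasure s (1 - s) ≤ 0 :=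
    integral_nonpos_of_ae ((ae_betaMeasure_mem_Ioo _ _).mono fun v hv =>
      sum_range_bernoulliGapCoeff_nonpos hv.1 hv.2.le k)
  rw [integral_finsetSum _ fun j _ => integrable_bernoulliGapCoeff hs hs1 j] at hint
  simp only [integral_bernoulliGapCoeff hs hs1, sum_neg_distrib, neg_nonpos,
    ← rpowSumCoeff₂_succ_eq_sum] at hint
  exact nonneg_of_mul_nonneg_left (div_eq_mul_inv (rpowSumCoeff₂ s _) _ ▸ hint) (by positivity)

theorem rpowSumCoeff₂_succ_le (k : ℕ) : rpowSumCoeff₂ s (k + 1) ≤ k ! / 2 := by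
  induction k with
  | zero => norm_num [rpowSumCoeff₂_succ, rpowSumCoeff₁_zero]
  | succ k ih =>
    rw [rpowSumCoeff₂_succ, Nat.factorial_succ]
    push_cast
    nlinarith [rpowSumCoeff₁_succ_nonpos hs hs1 k, (k.cast_nonneg : (0 : ℝ) ≤ k)]

theorem neg_rpowSumCoeff₁_succ_le (k : ℕ) : -rpowSumCoeff₁ s (k + 1) ≤ (k + 1)! / 2 := by
  have hnonneg := rpowSumCoeff₂_nonneg hs hs1 (k + 2)
  rw [rpowSumCoeff₂_succ, Nat.cast_succ] at hnonneg
  rw [Nat.factorial_succ]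
  push_cast
  nlinarith [rpowSumCoeff₂_succ_le hs hs1 k, (k.cast_nonneg : (0 : ℝ) ≤ k)]

theorem summable_integral_norm_bernoulliGapCoeff {w : ℝ} (hw : 0 ≤ w) (hw1 : w < 1) :
    Summable fun k => ∫ v, ‖bernoulliGapCoeff k v * w ^ k‖ ∂betaMeasure s (1 - s) := by
  rw [← summable_nat_add_iff 1]
  have hnorm (k : ℕ) : ∫ v, ‖bernoulliGapCoeff (k + 1) v * w ^ (k + 1)‖ ∂betaMeasure s (1 - s) =
      -rpowSumCoeff₁ s (k + 1) / (k + 1)! * w ^ (k + 1) := by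
    rw [neg_div, ← integral_bernoulliGapCoeff hs hs1, ← integral_mul_const]
    refine integral_congr_ae ((ae_betaMeasure_mem_Ioo _ _).mono fun v hv => ?_)
    exact norm_of_nonneg
      (mul_nonneg (bernoulliGapCoeff_succ_nonneg hv.1 hv.2.le k) (pow_nonneg hw _))
  refine .of_nonneg_of_le (fun k => integral_nonneg fun v => norm_nonneg _) (fun k => ?_)
    (((summable_nat_add_iff 1).mpr (summable_geometric_of_lt_one hw hw1)).mul_left (1 / 2))
  rw [hnorm]
  refine mul_le_mul_of_nonneg_right ?_ (pow_nonneg hw _)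
  rw [div_le_iff₀ (by positivity)]
  linarith [neg_rpowSumCoeff₁_succ_le hs hs1 k]

theorem hasSum_rpowSumCoeff₁ {t : ℝ} (ht : 0 < t) :
    HasSum (fun k => rpowSumCoeff₁ s k / k ! * (1 - exp (-t)) ^ k) (bernoulliGapMean s t) := by
  set w := 1 - exp (-t) with hw
  have hw0 : 0 ≤ w := by rw [hw, sub_nonneg, exp_le_one_iff]; linarith
  have hw1 : w < 1 := by linarith [exp_pos (-t)]
  have hswap := hasSum_integral_of_summable_integral_norm
    (fun k => (integrable_bernoulliGapCoeff hs hs1 k).mul_const (w ^ k))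
    (summable_integral_norm_bernoulliGapCoeff hs hs1 hw0 hw1)
  have hlimit : ∫ v, ∑' k, bernoulliGapCoeff k v * w ^ k ∂betaMeasure s (1 - s) =
      -bernoulliGapMean s t := by
    rw [bernoulliGapMean, ← integral_neg]
    exact integral_congr_ae ((ae_betaMeasure_mem_Ioo _ _).mono fun v hv =>
      (hasSum_bernoulliGapCoeff hv.1 hv.2.le ht).tsum_eq)
  rw [hlimit] at hswap
  simp only [integral_mul_const, integral_bernoulliGapCoeff hs hs1, neg_mul] at hswap
  simpa only [neg_neg] using hswap.neg

theorem hasSum_rpowSumCoeff₂ {t : ℝ} (ht : 0 < t) :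
    HasSum (fun k => rpowSumCoeff₂ s (k + 1) / k ! * (1 - exp (-t)) ^ k)
      (exp t * bernoulliGapMean s t) := by
  set w := 1 - exp (-t) with hw
  have hw0 : 0 < w := by rw [hw, sub_pos, exp_lt_one_iff]; linarith
  have hw1 : w < 1 := by linarith [exp_pos (-t)]
  have hgeom : HasValueAt (mk fun _ => 1) w (exp t) := by
    have := hasSum_geometric_of_lt_one hw0.le hw1
    rw [hw, sub_sub_cancel, ← exp_neg, neg_neg] at this
    simpa only [HasValueAt, coeff_mk, one_mul] using this
  have hmean : HasValueAt (mk fun k => rpowSumCoeff₁ s k / k !) w (bernoulliGapMean s t) := by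
    simpa only [HasValueAt, coeff_mk] using hasSum_rpowSumCoeff₁ hs hs1 ht
  rw [mul_comm]
  refine (hmean.mul hgeom).congr_fun fun k => ?_
  rw [coeff_mul, Nat.sum_antidiagonal_eq_sum_range_succ_mk, rpowSumCoeff₂_succ_eq_sum]
  simp only [coeff_mk, mul_one]

end Exponent

end BetaMixture

section Laplace

open Real MeasureTheory ProbabilityTheory

theorem integrableOn_exp_neg_mul_one_sub_exp_pow {x : ℝ} (hx : 0 < x) (k : ℕ) :
    IntegrableOn (fun t => exp (-(x * t)) * (1 - exp (-t)) ^ k) (Set.Ioi 0) := by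
  have hexp : IntegrableOn (fun t => exp (-(x * t))) (Set.Ioi 0) := by
    simpa only [neg_mul] using exp_neg_integrableOn_Ioi 0 hx
  refine Integrable.mono hexp (by fun_prop)
    ((ae_restrict_mem measurableSet_Ioi).mono fun t ht => ?_)
  rw [norm_mul]
  refine mul_le_of_le_one_right (norm_nonneg _) ?_
  have hle : exp (-t) ≤ 1 := exp_le_one_iff.mpr (neg_nonpos.mpr (le_of_lt ht))
  rw [norm_pow, norm_of_nonneg (sub_nonneg.mpr hle)]
  exact pow_le_one₀ (sub_nonneg.mpr hle) (by linarith [exp_pos (-t)])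

theorem integral_exp_neg_mul_one_sub_exp_pow {x : ℝ} (hx : 0 < x) (k : ℕ) :
    ∫ t in Set.Ioi 0, exp (-(x * t)) * (1 - exp (-t)) ^ k =
      k ! / (ascPochhammer ℝ (k + 1)).eval x := by
  induction k generalizing x with
  | zero =>
    simpa [neg_mul] using integral_exp_mul_Ioi (neg_lt_zero.mpr hx) 0
  | succ k ih =>
    have hstep (t : ℝ) : exp (-(x * t)) * (1 - exp (-t)) ^ (k + 1) =
        exp (-(x * t)) * (1 - exp (-t)) ^ k - exp (-((x + 1) * t)) * (1 - exp (-t)) ^ k := by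
      rw [add_one_mul, neg_add, exp_add]
      ring
    have hshift : x * (ascPochhammer ℝ (k + 1)).eval (x + 1) =
        (ascPochhammer ℝ (k + 1)).eval x * (x + (k + 1 : ℕ)) := by
      rw [← ascPochhammer_eval_succ_left, ascPochhammer_succ_eval]
    have hpos := ascPochhammer_pos (k + 1) x hx
    have hpos' := ascPochhammer_pos (k + 1) (x + 1) (by positivity)
    simp only [hstep]
    rw [integral_sub (integrableOn_exp_neg_mul_one_sub_exp_pow hx k)
      (integrableOn_exp_neg_mul_one_sub_exp_pow (by positivity) k), ih hx, ih (by positivity),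
      ascPochhammer_succ_eval (k + 1), ← hshift, Nat.factorial_succ, div_sub_div _ _ hpos.ne'
      hpos'.ne', div_eq_div_iff (by positivity) (by positivity)]
    push_cast at hshift ⊢
    linear_combination ((k ! : ℝ) * (ascPochhammer ℝ (k + 1)).eval (x + 1)) * hshift

theorem hasSum_laplace {x : ℝ} (hx : 0 < x) {a : ℕ → ℝ} (ha : ∀ k, 0 ≤ a k) {m : ℕ} {F : ℝ → ℝ}
    (hF : ∀ t, 0 < t → HasSum (fun k => a k * (1 - exp (-t)) ^ (k + m)) (F t))
    (hint : IntegrableOn (fun t => exp (-(x * t)) * F t) (Set.Ioi 0)) :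
    HasSum (fun k => a k * ((k + m)! / (ascPochhammer ℝ (k + m + 1)).eval x))
      (∫ t in Set.Ioi 0, exp (-(x * t)) * F t) := by
  have hsum : ∀ᵐ t ∂volume.restrict (Set.Ioi 0), HasSum
      (fun k => a k * (exp (-(x * t)) * (1 - exp (-t)) ^ (k + m))) (exp (-(x * t)) * F t) :=
    (ae_restrict_mem measurableSet_Ioi).mono fun t ht => by
      simpa only [mul_left_comm] using (hF t ht).mul_left (exp (-(x * t)))
  have hnorm (k : ℕ) : ∀ᵐ t ∂volume.restrict (Set.Ioi 0),
      ‖a k * (exp (-(x * t)) * (1 - exp (-t)) ^ (k + m))‖ ≤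
        a k * (exp (-(x * t)) * (1 - exp (-t)) ^ (k + m)) :=
    (ae_restrict_mem measurableSet_Ioi).mono fun t ht => by
      have hle : exp (-t) ≤ 1 := exp_le_one_iff.mpr (neg_nonpos.mpr (le_of_lt ht))
      exact (norm_of_nonneg (mul_nonneg (ha k) (mul_nonneg (exp_pos _).le
        (pow_nonneg (sub_nonneg.mpr hle) _)))).le
  refine (hasSum_integral_of_dominated_convergence _ (fun k => by fun_prop) hnorm
    (hsum.mono fun t ht => ht.summable)
    (hint.congr (hsum.mono fun t ht => ht.tsum_eq.symm)) hsum).congr_fun fun k => ?_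
  rw [integral_const_mul, integral_exp_neg_mul_one_sub_exp_pow hx]

theorem integrableOn_rpow_mul_exp_neg_mul {x p : ℝ} (hx : 0 < x) (hp : -1 < p) :
    IntegrableOn (fun u => u ^ p * exp (-(x * u))) (Set.Ioi 0) := by
  simpa only [rpow_one, neg_mul] using integrableOn_rpow_mul_exp_neg_mul_rpow hp one_pos hx

theorem integrableOn_bernoulliGap_mul {x s : ℝ} (hx : 0 < x) (hs : 0 < s) :
    IntegrableOn (fun u => bernoulliGap u * (u ^ (s - 1) * exp (-(x * u)))) (Set.Ioi 0) := by
  refine (integrableOn_rpow_mul_exp_neg_mul hx (by linarith : -1 < s - 1)).bdd_mul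
    (c := 1) measurable_bernoulliGap.aestronglyMeasurable
    ((ae_restrict_mem measurableSet_Ioi).mono fun u hu => ?_)
  rw [norm_of_nonneg (bernoulliGap_nonneg (le_of_lt hu))]
  exact bernoulliGap_le_one (le_of_lt hu)

theorem beta_mul_bernoulliGapMean {s : ℝ} (hs : 0 < s) (hs1 : s < 1) (t : ℝ) :
    beta s (1 - s) * bernoulliGapMean s t =
      ∫ v in (0 : ℝ)..1, v ^ (s - 1) * (1 - v) ^ (-s) * bernoulliGap (v * t) := by
  have hbeta := beta_pos hs (sub_pos.mpr hs1)
  rw [bernoulliGapMean, integral_betaMeasure hs (sub_pos.mpr hs1), ← integral_const_mul,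
    intervalIntegral.integral_of_le zero_le_one, integral_Ioc_eq_integral_Ioo,
    ← integral_indicator measurableSet_Ioo]
  congr 1 with v
  by_cases hv : 0 < v ∧ v < 1
  · rw [Set.indicator_of_mem (Set.mem_Ioo.mpr hv), betaPDFReal, if_pos hv, sub_sub_cancel_left]
    field_simp
  · rw [Set.indicator_of_notMem (mt Set.mem_Ioo.mp hv), betaPDFReal, if_neg hv, zero_mul, mul_zero]

theorem convolution_bernoulliGap {x s t : ℝ} (hs : 0 < s) (hs1 : s < 1) (ht : 0 < t) :
    ∫ u in (0 : ℝ)..t, bernoulliGap u * (u ^ (s - 1) * exp (-(x * u))) *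
      ((t - u) ^ (-s) * exp (-(x * (t - u)))) =
      beta s (1 - s) * (exp (-(x * t)) * bernoulliGapMean s t) := by
  have hsubst := intervalIntegral.mul_integral_comp_mul_right (a := 0) (b := 1)
    (f := fun u => bernoulliGap u * (u ^ (s - 1) * exp (-(x * u))) *
      ((t - u) ^ (-s) * exp (-(x * (t - u))))) (c := t)
  rw [zero_mul, one_mul] at hsubst
  rw [← hsubst, mul_left_comm, beta_mul_bernoulliGapMean hs hs1,
    ← intervalIntegral.integral_const_mul, ← intervalIntegral.integral_const_mul]
  refine intervalIntegral.integral_congr fun v hv => ?_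
  rw [Set.uIcc_of_le zero_le_one] at hv
  have hpow : t * (t ^ (s - 1) * t ^ (-s)) = 1 := by
    rw [← rpow_add ht, show s - 1 + -s = -1 by ring, rpow_neg_one, mul_inv_cancel₀ ht.ne']
  have hexp : exp (-(x * (v * t))) * exp (-(x * ((1 - v) * t))) = exp (-(x * t)) := by
    rw [← exp_add]
    ring_nf
  rw [show t - v * t = (1 - v) * t by ring, mul_rpow hv.1 ht.le,
    mul_rpow (sub_nonneg.mpr hv.2) ht.le, ← hexp]
  linear_combination (bernoulliGap (v * t) * v ^ (s - 1) * (1 - v) ^ (-s) *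
    (exp (-(x * (v * t))) * exp (-(x * ((1 - v) * t))))) * hpow

section Exponent

variable {x s : ℝ} (hx : 0 < x) (hs : 0 < s) (hs1 : s < 1)
include hx hs hs1

theorem integrableOn_exp_neg_mul_bernoulliGapMean :
    IntegrableOn (fun t => exp (-(x * t)) * bernoulliGapMean s t) (Set.Ioi 0) := by
  have hconv := integrable_posConvolution (integrableOn_bernoulliGap_mul hx hs)
    (integrableOn_rpow_mul_exp_neg_mul hx (neg_lt_neg hs1)) (ContinuousLinearMap.mul ℝ ℝ)
  refine ((hconv.integrableOn (s := Set.Ioi 0)).const_mul (beta s (1 - s))⁻¹).congr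
    ((ae_restrict_mem measurableSet_Ioi).mono fun t ht => ?_)
  simp only [posConvolution, Set.indicator_of_mem ht, ContinuousLinearMap.mul_apply']
  rw [convolution_bernoulliGap hs hs1 ht,
    inv_mul_cancel_left₀ (beta_pos hs (sub_pos.mpr hs1)).ne']

theorem integral_exp_neg_mul_bernoulliGapMean :
    ∫ t in Set.Ioi 0, exp (-(x * t)) * bernoulliGapMean s t =
      x ^ (s - 1) / Gamma s *
        ∫ u in Set.Ioi 0, bernoulliGap u * (u ^ (s - 1) * exp (-(x * u))) := by
  have hconv := integral_posConvolution (integrableOn_bernoulliGap_mul hx hs)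
    (integrableOn_rpow_mul_exp_neg_mul hx (neg_lt_neg hs1)) (ContinuousLinearMap.mul ℝ ℝ)
  simp only [ContinuousLinearMap.mul_apply'] at hconv
  rw [setIntegral_congr_fun measurableSet_Ioi fun t ht => convolution_bernoulliGap hs hs1 ht,
    integral_const_mul] at hconv
  have hgamma := integral_rpow_mul_exp_neg_mul_Ioi (sub_pos.mpr hs1) hx
  rw [sub_sub_cancel_left, one_div, inv_rpow hx.le, ← rpow_neg hx.le, neg_sub] at hgamma
  have hΓs := Gamma_pos_of_pos hs
  have hΓs1 := Gamma_pos_of_pos (sub_pos.mpr hs1)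
  rw [hgamma, beta, add_sub_cancel, Gamma_one, div_one] at hconv
  rw [div_mul_eq_mul_div, eq_div_iff hΓs.ne']
  refine mul_right_cancel₀ hΓs1.ne' ?_
  linear_combination hconv

end Exponent

end Laplace

section Zeta

open Finset Filter Topology Complex MeasureTheory

theorem mellinConvergent_and_differentiableAt_of_norm_le_exp {f : ℝ → ℂ} (hf : Measurable f)
    {x C : ℝ} (hx : 0 < x) (hbound : ∀ u, 0 < u → ‖f u‖ ≤ C * Real.exp (-x * u)) {s : ℂ}
    (hs : 0 < s.re) : MellinConvergent f s ∧ DifferentiableAt ℂ (mellin f) s := by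
  have hexp : Integrable (fun u => C * Real.exp (-x * u)) (volume.restrict (Set.Ioi 0)) :=
    (exp_neg_integrableOn_Ioi 0 hx).const_mul C
  have hint : IntegrableOn f (Set.Ioi 0) := hexp.mono' hf.aestronglyMeasurable
    ((ae_restrict_mem measurableSet_Ioi).mono fun u hu => hbound u hu)
  have htop : f =O[atTop] fun u => Real.exp (-x * u) :=
    .of_bound C ((eventually_gt_atTop 0).mono fun u hu => by
      simpa only [Real.norm_of_nonneg (Real.exp_pos _).le] using hbound u hu)
  have hbot : f =O[𝓝[>] 0] fun u => u ^ (-0 : ℝ) := by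
    refine .of_bound |C| (eventually_mem_nhdsWithin.mono fun u hu => (hbound u hu).trans ?_)
    rw [neg_zero, Real.rpow_zero, norm_one]
    refine mul_le_mul (le_abs_self C) (Real.exp_le_one_iff.mpr ?_) (Real.exp_pos _).le
      (abs_nonneg C)
    exact mul_nonpos_of_nonpos_of_nonneg (neg_nonpos.mpr hx.le) (le_of_lt hu)
  exact ⟨mellinConvergent_of_isBigO_rpow_exp hx hint.locallyIntegrableOn htop hbot hs,
    mellin_differentiableAt_of_isBigO_rpow_exp hx hint.locallyIntegrableOn htop hbot hs⟩

/-- The function whose Mellin transform is the remainder of the Euler-Maclaurin summation of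
`k ^ (-s)` from `x` onwards. -/
noncomputable def expBernoulliGap (x u : ℝ) : ℂ := (bernoulliGap u * Real.exp (-x * u) : ℝ)

theorem norm_expBernoulliGap_le (x : ℝ) {u : ℝ} (hu : 0 < u) :
    ‖expBernoulliGap x u‖ ≤ 1 * Real.exp (-x * u) := by
  rw [expBernoulliGap, norm_real,
    Real.norm_of_nonneg (mul_nonneg (bernoulliGap_nonneg hu.le) (Real.exp_pos _).le)]
  gcongr
  exact bernoulliGap_le_one hu.le

theorem measurable_expBernoulliGap (x : ℝ) : Measurable (expBernoulliGap x) :=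
  measurable_ofReal.comp (measurable_bernoulliGap.mul (by fun_prop))

theorem hasMellin_exp_neg_div {x : ℝ} (hx : 0 < x) {s : ℂ} (hs : 1 < s.re) :
    HasMellin (fun u : ℝ => (u : ℂ) ^ (-1 : ℂ) • (Real.exp (-x * u) : ℂ)) s
      ((x : ℂ) ^ (1 - s) * Gamma (s - 1)) := by
  have hs' : 0 < (s + -1).re := by simpa using hs
  refine ⟨MellinConvergent.cpow_smul.mpr
    (mellinConvergent_and_differentiableAt_of_norm_le_exp (C := 1) (by fun_prop) hx
      (fun u _ => ?_) hs').1, ?_⟩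
  · rw [norm_real, Real.norm_of_nonneg (Real.exp_pos _).le, one_mul]
  · have hgamma := integral_cpow_mul_exp_neg_mul_Ioi hs' hx
    rw [one_div, inv_cpow _ _ (by simp [arg_ofReal_of_nonneg hx.le, Real.pi_ne_zero.symm]),
      ← cpow_neg] at hgamma
    rw [mellin_cpow_smul, mellin]
    simpa [sub_eq_add_neg, add_comm] using hgamma

theorem hasSum_exp_neg_nat_add_one_mul {u : ℝ} (hu : 0 < u) (n : ℕ) :
    HasSum (fun k : ℕ => Real.exp (-(k + n + 1 : ℕ) * u))
      (Real.exp (-n * u) * (1 / (Real.exp u - 1))) := by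
  have hgeom := (hasSum_geometric_of_lt_one (Real.exp_pos (-u)).le
    (Real.exp_lt_one_iff.mpr (neg_lt_zero.mpr hu))).mul_left (Real.exp (-(n + 1 : ℕ) * u))
  convert! hgeom using 1
  · funext k
    rw [← Real.exp_nat_mul, ← Real.exp_add]
    push_cast
    ring_nf
  · have hcancel : Real.exp u * (1 - Real.exp (-u)) = Real.exp u - 1 := by
      rw [mul_sub, ← Real.exp_add, add_neg_cancel, Real.exp_zero, mul_one]
    rw [← hcancel, one_div, mul_inv, ← Real.exp_neg, ← mul_assoc, ← Real.exp_add]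
    push_cast
    ring_nf

theorem hasSum_mellin_exp_neg_div_exp_sub_one (n : ℕ) {s : ℂ} (hs : 1 < s.re) :
    HasSum (fun k : ℕ => Gamma s * (1 / ((k + n : ℕ) + 1 : ℂ) ^ s))
      (mellin (fun u => ((Real.exp (-n * u) * (1 / (Real.exp u - 1)) : ℝ) : ℂ)) s) := by
  have hsummable : Summable fun k : ℕ => ‖(1 : ℂ)‖ / ((k + n + 1 : ℕ) : ℝ) ^ s.re := by
    simpa only [norm_one, add_assoc] using
      (summable_nat_add_iff (n + 1)).mpr (Real.summable_one_div_nat_rpow.mpr hs)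
  have hdirichlet := hasSum_mellin (a := fun _ : ℕ => 1) (p := fun k => ((k + n + 1 : ℕ) : ℝ))
    (fun k => .inr (by positivity)) (zero_lt_one.trans hs)
    (fun u hu => by
      simpa only [one_mul] using hasSum_ofReal.mpr (hasSum_exp_neg_nat_add_one_mul hu n)) hsummable
  refine hdirichlet.congr_fun fun k => ?_
  push_cast
  ring

theorem hasSum_one_div_nat_add_one_cpow (n : ℕ) {s : ℂ} (hs : 1 < s.re) :
    HasSum (fun k : ℕ => 1 / ((k + n : ℕ) + 1 : ℂ) ^ s)
      (riemannZeta s - ∑ k ∈ range n, 1 / (k + 1 : ℂ) ^ s) := by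
  have hsummable : Summable fun k : ℕ => 1 / (k + 1 : ℂ) ^ s := by
    simpa using (summable_nat_add_iff 1).mpr (summable_one_div_nat_cpow.mpr hs)
  rw [zeta_eq_tsum_one_div_nat_add_one_cpow hs]
  exact (hasSum_nat_add_iff' n).mpr hsummable.hasSum

theorem mellin_expBernoulliGap_of_one_lt_re {n : ℕ} (hn : 0 < n) {s : ℂ} (hs : 1 < s.re) :
    mellin (expBernoulliGap n) s = (n : ℂ) ^ (1 - s) * Gamma (s - 1) -
      Gamma s * (riemannZeta s - ∑ k ∈ range n, 1 / (k + 1 : ℂ) ^ s) := by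
  have hn' : (0 : ℝ) < n := Nat.cast_pos.mpr hn
  have hdiv := hasMellin_exp_neg_div hn' hs
  have hgap := (mellinConvergent_and_differentiableAt_of_norm_le_exp
    (measurable_expBernoulliGap n) hn' (fun u => norm_expBernoulliGap_le n)
    (zero_lt_one.trans hs)).1
  have hsub := (hasMellin_sub hdiv.1 hgap).2
  have hdirichlet := (hasSum_mellin_exp_neg_div_exp_sub_one n hs).unique
    ((hasSum_one_div_nat_add_one_cpow n hs).mul_left (Gamma s))
  have hsplit (u : ℝ) : (u : ℂ) ^ (-1 : ℂ) • (Real.exp (-n * u) : ℂ) - expBernoulliGap n u =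
      (Real.exp (-n * u) * (1 / (Real.exp u - 1)) : ℝ) := by
    rw [expBernoulliGap, bernoulliGap, cpow_neg_one, smul_eq_mul]
    push_cast
    ring
  simp only [hsplit, hdirichlet, hdiv.2, ofReal_natCast] at hsub
  linear_combination hsub

theorem sub_one_mul_sum_range_one_div_cpow_of_one_lt_re {n : ℕ} (hn : 0 < n) {s : ℂ}
    (hs : 1 < s.re) : (s - 1) * ∑ k ∈ range n, 1 / (k + 1 : ℂ) ^ s =
      riemannZeta₁ s - (n : ℂ) ^ (1 - s) +
        (s - 1) * (mellin (expBernoulliGap n) s * (Gamma s)⁻¹) := by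
  have hs1 : s - 1 ≠ 0 := sub_ne_zero.mpr (by rintro rfl; simp at hs)
  have hΓ := Gamma_ne_zero_of_re_pos (zero_lt_one.trans hs)
  have hΓ_succ := Gamma_add_one (s - 1) hs1
  rw [sub_add_cancel] at hΓ_succ
  rw [mellin_expBernoulliGap_of_one_lt_re hn hs, riemannZeta_eq_inv_sub_mul (sub_ne_zero.mp hs1)]
  field_simp
  linear_combination (n : ℂ) ^ (1 - s) * hΓ_succ

theorem sub_one_mul_sum_range_one_div_cpow {n : ℕ} (hn : 0 < n) {s : ℂ} (hs : 0 < s.re) :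
    (s - 1) * ∑ k ∈ range n, 1 / (k + 1 : ℂ) ^ s =
      riemannZeta₁ s - (n : ℂ) ^ (1 - s) +
        (s - 1) * (mellin (expBernoulliGap n) s * (Gamma s)⁻¹) := by
  have hn' : (0 : ℝ) < n := Nat.cast_pos.mpr hn
  have hopen (c : ℝ) : IsOpen {z : ℂ | c < z.re} := isOpen_lt continuous_const continuous_re
  have hsum : Differentiable ℂ fun z : ℂ => (z - 1) * ∑ k ∈ range n, 1 / (k + 1 : ℂ) ^ z := by
    refine (differentiable_id.sub_const 1).mul (.fun_sum fun k _ z => ?_)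
    have hpos : (k + 1 : ℂ) ≠ 0 := k.cast_add_one_ne_zero
    exact (differentiableAt_const 1).div (differentiableAt_id.const_cpow (.inl hpos))
      (by simp [cpow_eq_zero_iff, hpos])
  have hzeta : DifferentiableOn ℂ (fun z => riemannZeta₁ z - (n : ℂ) ^ (1 - z) +
      (z - 1) * (mellin (expBernoulliGap n) z * (Gamma z)⁻¹)) {z | 0 < z.re} := fun z hz => by
    have hpow : DifferentiableAt ℂ (fun z => (n : ℂ) ^ (1 - z)) z :=
      (differentiableAt_id.const_sub 1).const_cpow (.inl (Nat.cast_ne_zero.mpr hn.ne'))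
    have hmellin := (mellinConvergent_and_differentiableAt_of_norm_le_exp
      (measurable_expBernoulliGap n) hn' (fun u => norm_expBernoulliGap_le n) hz).2
    exact (((differentiable_riemannZeta₁ z).sub hpow).add ((differentiableAt_id.sub_const 1).mul
      (hmellin.mul (differentiable_one_div_Gamma z)))).differentiableWithinAt
  exact (hsum.differentiableOn.analyticOnNhd (hopen 0)).eqOn_of_preconnected_of_eventuallyEq
    (hzeta.analyticOnNhd (hopen 0)) (convex_halfSpace_re_gt 0).isPreconnected
    (z₀ := 2) (by simp)
    (Eventually.mono ((hopen 1).mem_nhds (show (1 : ℝ) < (2 : ℂ).re by norm_num))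
      fun z hz => sub_one_mul_sum_range_one_div_cpow_of_one_lt_re hn hz) hs

theorem mellin_expBernoulliGap_ofReal (x s : ℝ) :
    mellin (expBernoulliGap x) s =
      (∫ u in Set.Ioi 0, bernoulliGap u * (u ^ (s - 1) * Real.exp (-(x * u))) : ℝ) := by
  rw [mellin, ← integral_complex_ofReal]
  refine setIntegral_congr_fun measurableSet_Ioi fun u hu => ?_
  simp only [expBernoulliGap, smul_eq_mul, neg_mul]
  rw [← ofReal_one, ← ofReal_sub, ← ofReal_cpow (le_of_lt hu)]
  push_cast
  ring

theorem sum_one_div_rpow_eq_riemannZeta {n : ℕ} (hn : 0 < n) {s : ℝ} (hs : 0 < s) (hs1 : s ≠ 1) :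
    ((∑ k ∈ Icc 1 n, 1 / (k : ℝ) ^ s : ℝ) : ℂ) =
      ((n : ℝ) ^ (1 - s) / (1 - s) : ℝ) + riemannZeta s +
        ((∫ u in Set.Ioi 0, bernoulliGap u * (u ^ (s - 1) * Real.exp (-(n * u)))) /
          Real.Gamma s : ℝ) := by
  have hs1' : (s : ℂ) - 1 ≠ 0 := sub_ne_zero.mpr (mod_cast hs1)
  have hmain := sub_one_mul_sum_range_one_div_cpow hn (s := s) hs
  have hsum : ((∑ k ∈ Icc 1 n, 1 / (k : ℝ) ^ s : ℝ) : ℂ) =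
      ∑ k ∈ range n, 1 / (k + 1 : ℂ) ^ (s : ℂ) := by
    have hterm (k : ℕ) : 1 / (k + 1 : ℂ) ^ (s : ℂ) = (1 / ((k + 1 : ℕ) : ℝ) ^ s : ℝ) := by
      rw [ofReal_div, ofReal_cpow (Nat.cast_nonneg (k + 1))]
      push_cast
      rfl
    simp only [hterm, ← ofReal_sum]
    rw [range_eq_Ico, sum_Ico_add' (fun k : ℕ => 1 / (k : ℝ) ^ s) 0 n 1, zero_add,
      Ico_add_one_right_eq_Icc]
  rw [← ofReal_natCast n, mellin_expBernoulliGap_ofReal] at hmain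
  rw [hsum, riemannZeta_eq_inv_sub_mul (mod_cast hs1)]
  simp only [ofReal_div, ofReal_cpow (Nat.cast_nonneg n), ← Complex.Gamma_ofReal,
    ofReal_sub, ofReal_one] at hmain ⊢
  rw [← neg_sub (s : ℂ) 1, div_neg]
  refine mul_left_cancel₀ hs1' (hmain.trans ?_)
  rw [mul_add, mul_add, mul_neg, mul_div_cancel₀ _ hs1', mul_inv_cancel_left₀ hs1',
    neg_sub, ← div_eq_mul_inv]
  ring

end Zeta

section RpowSum

open Finset Real MeasureTheory

theorem shiftedRising_eq_ascPochhammer_eval (n k : ℕ) :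
    shiftedRising n k = (ascPochhammer ℝ k).eval (n + 1 : ℝ) := by
  induction k with
  | zero => simp [shiftedRising]
  | succ k ih =>
    rw [shiftedRising, prod_Icc_succ_top (by lia), ← shiftedRising, ih, ascPochhammer_succ_eval]
    push_cast
    ring

theorem hasSum_rpowSumCoeff₁_div {x : ℝ} (hx : 0 < x) {s : ℝ} (hs : 0 < s) (hs1 : s < 1) :
    HasSum (fun k => rpowSumCoeff₁ s (k + 1) / (x * (ascPochhammer ℝ (k + 1)).eval (x + 1)))
      ((∫ t in Set.Ioi 0, exp (-(x * t)) * bernoulliGapMean s t) - 1 / (2 * x)) := by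
  have hmean := integrableOn_exp_neg_mul_bernoulliGapMean hx hs hs1
  have hexp : IntegrableOn (fun t => exp (-(x * t))) (Set.Ioi 0) := by
    simpa only [neg_mul] using exp_neg_integrableOn_Ioi 0 hx
  have hintegral : ∫ t in Set.Ioi 0, exp (-(x * t)) = 1 / x := by
    simpa using integral_exp_neg_mul_one_sub_exp_pow hx 0
  have hsplit (t : ℝ) : exp (-(x * t)) * (1 / 2 - bernoulliGapMean s t) =
      exp (-(x * t)) / 2 - exp (-(x * t)) * bernoulliGapMean s t := by ring
  have hlaplace := hasSum_laplace (a := fun k => -rpowSumCoeff₁ s (k + 1) / (k + 1)!) (m := 1) hx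
    (fun k => div_nonneg (neg_nonneg.mpr (rpowSumCoeff₁_succ_nonpos hs hs1 k)) (by positivity))
    (F := fun t => 1 / 2 - bernoulliGapMean s t) (fun t ht => by
      have htail := ((hasSum_nat_add_iff' 1).mpr (hasSum_rpowSumCoeff₁ hs hs1 ht)).neg
      simpa [rpowSumCoeff₁_zero, neg_div] using htail)
    (by simp only [hsplit]; exact (hexp.div_const 2).sub hmean)
  simp only [hsplit] at hlaplace
  rw [integral_sub (hexp.div_const 2) hmean, integral_div, hintegral] at hlaplace
  convert! hlaplace.neg using 1
  · funext k
    rw [ascPochhammer_eval_succ_left x (k + 1)]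
    have : ((k + 1)! : ℝ) ≠ 0 := by positivity
    field_simp
  · ring

theorem hasSum_rpowSumCoeff₂_div {x : ℝ} (hx : 0 < x) {s : ℝ} (hs : 0 < s) (hs1 : s < 1) :
    HasSum (fun k => rpowSumCoeff₂ s (k + 1) / (ascPochhammer ℝ (k + 1)).eval (x + 1))
      (∫ t in Set.Ioi 0, exp (-(x * t)) * bernoulliGapMean s t) := by
  have hshift (t : ℝ) : exp (-((x + 1) * t)) * (exp t * bernoulliGapMean s t) =
      exp (-(x * t)) * bernoulliGapMean s t := by
    rw [← mul_assoc, ← exp_add]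
    ring_nf
  have hlaplace := hasSum_laplace (a := fun k => rpowSumCoeff₂ s (k + 1) / k !) (m := 0)
    (x := x + 1) (by positivity)
    (fun k => div_nonneg (rpowSumCoeff₂_nonneg hs hs1 (k + 1)) (by positivity))
    (fun t ht => hasSum_rpowSumCoeff₂ hs hs1 ht)
    (by simpa only [hshift] using integrableOn_exp_neg_mul_bernoulliGapMean hx hs hs1)
  simp only [hshift] at hlaplace
  refine hlaplace.congr_fun fun k => ?_
  have : (k ! : ℝ) ≠ 0 := by positivity
  field_simp
  rfl

theorem sum_one_div_rpow_eq_riemannZeta_add_integral {n : ℕ} (hn : 0 < n) {s : ℝ} (hs : 0 < s)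
    (hs1 : s < 1) :
    ((∑ k ∈ Icc 1 n, 1 / (k : ℝ) ^ s : ℝ) : ℂ) =
      ((n : ℝ) ^ (1 - s) / (1 - s) : ℝ) + riemannZeta s +
        ((n : ℝ) ^ (1 - s) *
          ∫ t in Set.Ioi 0, exp (-(n * t)) * bernoulliGapMean s t : ℝ) := by
  have hn' : (0 : ℝ) < n := Nat.cast_pos.mpr hn
  rw [sum_one_div_rpow_eq_riemannZeta hn hs hs1.ne,
    integral_exp_neg_mul_bernoulliGapMean hn' hs hs1, ← mul_assoc, mul_div_assoc', ← rpow_add hn',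
    sub_add_sub_cancel, sub_self, rpow_zero, one_div_mul_eq_div]

theorem mainTheorem6_general {n : ℕ} (hn : 0 < n) {s : ℝ} (hs : 0 < s) (hs1 : s < 1) :
    (Summable fun k : ℕ => rpowSumCoeff₁ s (k + 1) / ((n : ℝ) ^ s * shiftedRising n (k + 1))) ∧
    ((∑ k ∈ Icc 1 n, 1 / (k : ℝ) ^ s : ℝ) : ℂ) =
      ((n : ℝ) ^ (1 - s) / (1 - s) : ℝ) + riemannZeta s + (1 / (2 * (n : ℝ) ^ s) : ℝ) +
        (∑' k : ℕ, rpowSumCoeff₁ s (k + 1) / ((n : ℝ) ^ s * shiftedRising n (k + 1)) : ℝ) ∧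
    (Summable fun k : ℕ => rpowSumCoeff₂ s (k + 1) / shiftedRising n (k + 1)) ∧
    ((∑ k ∈ Icc 1 n, 1 / (k : ℝ) ^ s : ℝ) : ℂ) =
      ((n : ℝ) ^ (1 - s) / (1 - s) : ℝ) + riemannZeta s +
        ((n : ℝ) ^ (1 - s) * ∑' k : ℕ, rpowSumCoeff₂ s (k + 1) / shiftedRising n (k + 1) : ℝ) := by
  have hn' : (0 : ℝ) < n := Nat.cast_pos.mpr hn
  have hpow : (n : ℝ) ^ (1 - s) = n / (n : ℝ) ^ s := by rw [rpow_sub hn', rpow_one]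
  have hseries₁ := (hasSum_rpowSumCoeff₁_div hn' hs hs1).mul_left ((n : ℝ) ^ (1 - s))
  have hseries₂ := hasSum_rpowSumCoeff₂_div hn' hs hs1
  have hterm₁ (k : ℕ) : (n : ℝ) ^ (1 - s) *
      (rpowSumCoeff₁ s (k + 1) / (n * shiftedRising n (k + 1))) =
        rpowSumCoeff₁ s (k + 1) / ((n : ℝ) ^ s * shiftedRising n (k + 1)) := by
    rw [hpow]
    field_simp
  have hone : (n : ℝ) ^ (1 - s) * (1 / (2 * n)) = 1 / (2 * (n : ℝ) ^ s) := by
    rw [hpow]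
    field_simp
  simp only [← shiftedRising_eq_ascPochhammer_eval, hterm₁, mul_sub, hone] at hseries₁ hseries₂
  refine ⟨hseries₁.summable, ?_, hseries₂.summable, ?_⟩
  · rw [hseries₁.tsum_eq, sum_one_div_rpow_eq_riemannZeta_add_integral hn hs hs1,
      Complex.ofReal_sub]
    ring
  · rw [hseries₂.tsum_eq, sum_one_div_rpow_eq_riemannZeta_add_integral hn hs hs1]

end RpowSum

section InvSqrt

open Finset

theorem ascPochhammer_eval_one_half (l : ℕ) :
    (ascPochhammer ℝ l).eval (1 / 2) = ((2 * l - 1)‼ : ℝ) / 2 ^ l := by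
  induction l with
  | zero => simp
  | succ l ih =>
    have hstep : (2 * (l + 1) - 1)‼ = (2 * l + 1) * (2 * l - 1)‼ := by
      cases l with
      | zero => rfl
      | succ l => exact Nat.doubleFactorial_add_two (2 * l + 1)
    rw [ascPochhammer_succ_eval, ih, hstep]
    push_cast
    field_simp
    ring

theorem neg_one_pow_mul_neg_one_pow_mul_stirlingS (k l : ℕ) :
    (-1 : ℝ) ^ k * ((-1) ^ l * stirlingS k l) = Nat.stirlingFirst k l := by
  rw [← mul_assoc, ← pow_add, stirlingS]
  push_cast
  rw [← mul_assoc, ← pow_add, Even.neg_one_pow ⟨_, rfl⟩, one_mul]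

theorem invSqrtCoeff₁_succ (k : ℕ) :
    (invSqrtCoeff₁ (k + 1) : ℝ) = rpowSumCoeff₁ (1 / 2) (k + 1) := by
  rw [invSqrtCoeff₁, rpowSumCoeff₁, range_eq_Ico, sum_eq_sum_Ico_succ_bot (by lia), zero_add,
    Nat.stirlingFirst_succ_zero, Nat.cast_zero, zero_mul, zero_add, Ico_add_one_right_eq_Icc,
    mul_sum, ← sum_neg_distrib]
  push_cast
  refine sum_congr rfl fun l _ => ?_
  rw [← neg_one_pow_mul_neg_one_pow_mul_stirlingS, ascPochhammer_eval_one_half]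
  ring

theorem invSqrtCoeff₂_eq (k : ℕ) : (invSqrtCoeff₂ k : ℝ) = rpowSumCoeff₂ (1 / 2) k := by
  rw [invSqrtCoeff₂, rpowSumCoeff₂, range_eq_Ico, ← Ico_add_one_right_eq_Icc,
    ← sum_Ico_add' _ 0 k 1, mul_sum, ← sum_neg_distrib]
  push_cast
  refine sum_congr rfl fun l _ => ?_
  rw [← neg_one_pow_mul_neg_one_pow_mul_stirlingS, ascPochhammer_eval_one_half,
    show 2 * (l + 1) - 3 = 2 * l - 1 by lia]
  ring

theorem bernoulli_four : bernoulli 4 = -1 / 30 := by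
  rw [bernoulli_eq_bernoulli'_of_ne_one (by norm_num), bernoulli'_four]

theorem invSqrtCoeff₁_values : invSqrtCoeff₁ 1 = -1 / 24 ∧ invSqrtCoeff₁ 2 = -1 / 24 ∧
    invSqrtCoeff₁ 3 = -31 / 384 ∧ invSqrtCoeff₁ 4 = -15 / 64 := by
  have hbernoulli_three : bernoulli 3 = 0 := bernoulli_eq_zero_of_odd (by decide) (by norm_num)
  have hbernoulli_five : bernoulli 5 = 0 := bernoulli_eq_zero_of_odd (by decide) (by norm_num)
  refine ⟨?_, ?_, ?_, ?_⟩ <;>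
  norm_num [invSqrtCoeff₁, stirlingS, sum_Icc_succ_top, bernoulli_two, hbernoulli_three,
    bernoulli_four, hbernoulli_five, Nat.doubleFactorial, Nat.factorial, Nat.stirlingFirst]

theorem invSqrtCoeff₂_values : invSqrtCoeff₂ 1 = 1 / 2 ∧ invSqrtCoeff₂ 2 = 11 / 24 ∧
    invSqrtCoeff₂ 3 = 7 / 8 ∧ invSqrtCoeff₂ 4 = 977 / 384 := by
  have hbernoulli_three : bernoulli 3 = 0 := bernoulli_eq_zero_of_odd (by decide) (by norm_num)
  refine ⟨?_, ?_, ?_, ?_⟩ <;>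
  norm_num [invSqrtCoeff₂, stirlingS, sum_Icc_succ_top, bernoulli_one, bernoulli_two,
    hbernoulli_three, bernoulli_four, Nat.doubleFactorial, Nat.factorial, Nat.stirlingFirst]

end InvSqrt

theorem mainTheorem6 :
    (∀ n : ℕ, 1 ≤ n →
      (Summable fun k : ℕ =>
          (invSqrtCoeff₁ (k + 1) : ℝ) / (√(n : ℝ) * shiftedRising n (k + 1))) ∧
      ((∑ k ∈ Finset.Icc 1 n, 1 / √(k : ℝ) : ℝ) : ℂ) =
        ((2 * √(n : ℝ) : ℝ) : ℂ) + riemannZeta (1 / 2) + ((1 / (2 * √(n : ℝ)) : ℝ) : ℂ) +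
          ((∑' k : ℕ,
            (invSqrtCoeff₁ (k + 1) : ℝ) / (√(n : ℝ) * shiftedRising n (k + 1)) : ℝ) : ℂ) ∧
      (Summable fun k : ℕ => (invSqrtCoeff₂ (k + 1) : ℝ) / shiftedRising n (k + 1)) ∧
      ((∑ k ∈ Finset.Icc 1 n, 1 / √(k : ℝ) : ℝ) : ℂ) =
        ((2 * √(n : ℝ) : ℝ) : ℂ) + riemannZeta (1 / 2) +
          ((√(n : ℝ) *
            ∑' k : ℕ, (invSqrtCoeff₂ (k + 1) : ℝ) / shiftedRising n (k + 1) : ℝ) : ℂ)) ∧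
    (invSqrtCoeff₁ 1 = -1 / 24 ∧ invSqrtCoeff₁ 2 = -1 / 24 ∧
      invSqrtCoeff₁ 3 = -31 / 384 ∧ invSqrtCoeff₁ 4 = -15 / 64) ∧
    (invSqrtCoeff₂ 1 = 1 / 2 ∧ invSqrtCoeff₂ 2 = 11 / 24 ∧
      invSqrtCoeff₂ 3 = 7 / 8 ∧ invSqrtCoeff₂ 4 = 977 / 384) := by
  refine ⟨fun n hn => ?_, invSqrtCoeff₁_values, invSqrtCoeff₂_values⟩
  have hhalf : (1 : ℝ) - 2⁻¹ = 2⁻¹ := by norm_num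
  simpa [invSqrtCoeff₁_succ, invSqrtCoeff₂_eq, Real.sqrt_eq_rpow, hhalf, mul_comm] using
    mainTheorem6_general hn (s := 1 / 2) (by norm_num) (by norm_num)
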